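/- Let $\mathsf S$ be an essentially small tensor triangulated category, that is, an essentially small triangulated category with a symmetric monoidal structure $(\otimes,\mathbf 1)$ such that $\otimes$ is exact in each variable. A \emph{tensor ideal} of $\mathsf S$ is a thick subcategory $\mathsf P$ (a full triangulated subcategory closed under direct summands) such that $s\otimes p\in\mathsf P$ for all $s\in\mathsf S$, $p\in\mathsf P$; it is \emph{prime} if it is proper and $s\otimes s'\in\mathsf P$ implies $s\in\mathsf P$ or $s'\in\mathsf P$. The spectrum $\operatorname{Spc}\mathsf S$ is the set of prime tensor ideals with the topology for which the sets $\operatorname{supp}_{\mathsf S}s=\{\mathsf P\mid s\notin\mathsf P\}$, $s\in\mathsf S$, form a basis of closed sets, and for a subcategory $\mathsf C$ put $\operatorname{supp}_{\mathsf S}\mathsf C=\bigcup_{c\in\mathsf C}\operatorname{supp}_{\mathsf S}c$. A strong monoidal exact functor $F\colon\mathsf S\to\mathsf S'$ induces $\operatorname{Spc}(F)\colon\operatorname{Spc}\mathsf S'\to\operatorname{Spc}\mathsf S$, $\mathsf P\mapsto F^{-1}(\mathsf P)$. Let $\mathsf R\underset{i^!}{\overset{i_*}{\rightleftarrows}}\mathsf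 S\underset{j_*}{\overset{j^*}{\rightleftarrows}}\mathsf T$ be a localisation sequence of triangulated categories: $i_*$ and $j_*$ are fully faithful exact functors, $i^!$ is right adjoint to $i_*$, $j^*$ is left adjoint to $j_*$, $(i_*\mathsf R)^\perp=j_*\mathsf T$ and $i_*\mathsf R={}^\perp(j_*\mathsf T)$, where $i_*\mathsf R$, $j_*\mathsf T$ denote the essential images. Assume that $i_*\mathsf R$ and $j_*\mathsf T$ are tensor ideals of $\mathsf S$, and regard $\mathsf R$ and $\mathsf T$ as tensor triangulated categories with the tensor product of $\mathsf S$ and with units $i^!\mathbf 1$ and $j^*\mathbf 1$, so that $i^!$ and $j^*$ are strong monoidal and exact. Then: (1) $\operatorname{Spc}(i^!)\colon\operatorname{Spc}\mathsf R\to\operatorname{Spc}\mathsf S$ is a homeomorphism onto $\operatorname{supp}_{\mathsf S}i_*\mathsf R$, $\operatorname{Spc}(j^*)\colon\operatorname{Spc}\mathsf T\to\operatorname{Spc}\mathsf S$ is a homeomorphism onto $\operatorname{supp}_{\mathsf S}j_*\mathsf T$, and both of these subsets are open and closed in $\operatorname{Spc}\mathsf S$. (2) $\operatorname{Spc}\mathsf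 S$ is the disjoint union of these two subsets, and the induced map $\operatorname{Spc}\mathsf R\sqcup\operatorname{Spc}\mathsf T\to\operatorname{Spc}\mathsf S$ is a homeomorphism. (3) If $\mathsf R\neq 0$ and $\mathsf T\neq 0$, then $\operatorname{Spc}\mathsf S$ is disconnected, that is, it is the union of two disjoint non-empty open subsets. -/

import Mathlib

open CategoryTheory CategoryTheory.Limits MonoidalCategory Topology

universe w v₁ v₂ v₃ u₁ u₂ u₃

/-- A functor between triangulated categories is *exact* if it can be equipped with a natural
isomorphism with the shift functors for which it preserves distinguished triangles. -/
def IsExactFunctor {C D : Type*} [Category* C] [Category* D]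
    [HasZeroObject C] [HasShift C ℤ] [Preadditive C]
    [∀ n : ℤ, (shiftFunctor C n).Additive] [Pretriangulated C]
    [HasZeroObject D] [HasShift D ℤ] [Preadditive D]
    [∀ n : ℤ, (shiftFunctor D n).Additive] [Pretriangulated D] (F : C ⥤ D) : Prop :=
  ∃ _ : F.CommShift ℤ, F.IsTriangulated

section Exact

variable {C D E : Type*} [Category* C] [Category* D] [Category* E]
    [HasZeroObject C] [HasShift C ℤ] [Preadditive C]
    [∀ n : ℤ, (shiftFunctor C n).Additive] [Pretriangulated C]
    [HasZeroObject D] [HasShift D ℤ] [Preadditive D]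
    [∀ n : ℤ, (shiftFunctor D n).Additive] [Pretriangulated D]
    [HasZeroObject E] [HasShift E ℤ] [Preadditive E]
    [∀ n : ℤ, (shiftFunctor E n).Additive] [Pretriangulated E]

lemma IsExactFunctor.comp {F : C ⥤ D} {G : D ⥤ E} (hF : IsExactFunctor F)
    (hG : IsExactFunctor G) : IsExactFunctor (F ⋙ G) := by
  obtain ⟨_, _⟩ := hF
  obtain ⟨_, _⟩ := hG
  exact ⟨inferInstance, inferInstance⟩

lemma IsExactFunctor.of_iso {F G : C ⥤ D} (hF : IsExactFunctor F) (e : F ≅ G) :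
    IsExactFunctor G := by
  obtain ⟨_, _⟩ := hF
  let _ := Functor.CommShift.ofIso e ℤ
  have := Functor.CommShift.ofIso_compatibility e ℤ
  exact ⟨inferInstance, Functor.isTriangulated_of_iso e⟩

lemma IsExactFunctor.rightAdjoint {F : C ⥤ D} {G : D ⥤ C} (adj : F ⊣ G)
    (hF : IsExactFunctor F) : IsExactFunctor G := by
  obtain ⟨_, _⟩ := hF
  let _ := adj.rightAdjointCommShift ℤ
  have := adj.commShift_of_leftAdjoint ℤ
  exact ⟨inferInstance, adj.isTriangulated_rightAdjoint⟩

lemma IsExactFunctor.leftAdjoint {F : C ⥤ D} {G : D ⥤ C} (adj : F ⊣ G)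
    (hG : IsExactFunctor G) : IsExactFunctor F := by
  obtain ⟨_, _⟩ := hG
  let _ := adj.leftAdjointCommShift ℤ
  have := adj.commShift_of_rightAdjoint ℤ
  exact ⟨inferInstance, adj.isTriangulated_leftAdjoint⟩

/-- An exact functor inverts a morphism if and only if it kills a cone of it. -/
lemma IsExactFunctor.isIso_map_iff {F : C ⥤ D} (hF : IsExactFunctor F)
    {T : Pretriangulated.Triangle C} (hT : T ∈ Pretriangulated.distinguishedTriangles) :
    IsIso (F.map T.mor₁) ↔ IsZero (F.obj T.obj₃) := by
  obtain ⟨_, _⟩ := hF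
  exact (Pretriangulated.Triangle.isZero₃_iff_isIso₁ _ (F.map_distinguished T hT)).symm

end Exact

/-- A tensor triangulated category: a triangulated category with a symmetric monoidal structure
whose tensor product is exact in each variable. -/
class TensorTriangulatedCategory (C : Type*) [Category* C]
    [HasZeroObject C] [HasShift C ℤ] [Preadditive C]
    [∀ n : ℤ, (shiftFunctor C n).Additive] [Pretriangulated C]
    extends MonoidalCategory C, SymmetricCategory C where
  exact_tensorLeft (X : C) : IsExactFunctor (tensorLeft X)
  exact_tensorRight (X : C) : IsExactFunctor (tensorRight X)

section Spectrum

variable {C : Type*} [Category* C]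
    [HasZeroObject C] [HasShift C ℤ] [Preadditive C]
    [∀ n : ℤ, (shiftFunctor C n).Additive] [Pretriangulated C] [TensorTriangulatedCategory C]

/-- Tensor ideals: thick (i.e. triangulated and closed under retracts, in particular replete)
full subcategories closed under tensoring with arbitrary objects. -/
structure IsTensorIdeal (P : ObjectProperty C) : Prop where
  isTriangulated : P.IsTriangulated
  isStableUnderRetracts : P.IsStableUnderRetracts
  tensor_mem : ∀ X Y : C, P Y → P (X ⊗ Y)

variable (C) in
/-- The set of prime tensor ideals of a tensor triangulated category. -/
structure Spc where
  /-- the underlying full subcategory -/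
  ideal : ObjectProperty C
  isTensorIdeal : IsTensorIdeal ideal
  proper : ∃ X : C, ¬ ideal X
  prime : ∀ X Y : C, ideal (X ⊗ Y) → ideal X ∨ ideal Y

/-- The support of an object. -/
def Spc.supp (X : C) : Set (Spc C) := {P | ¬ P.ideal X}

/-- The support of a full subcategory. -/
def Spc.suppOf (A : ObjectProperty C) : Set (Spc C) := ⋃ (X : C) (_ : A X), Spc.supp X

/-- The Zariski topology, in which the supports of objects form a basis of closed subsets. -/
instance Spc.instTopologicalSpace : TopologicalSpace (Spc C) :=
  TopologicalSpace.generateFrom {U | ∃ X : C, U = (Spc.supp X)ᶜ}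

variable {D : Type*} [Category* D]
    [HasZeroObject D] [HasShift D ℤ] [Preadditive D]
    [∀ n : ℤ, (shiftFunctor D n).Additive] [Pretriangulated D] [TensorTriangulatedCategory D]

/-- The map on spectra induced by a strong monoidal exact functor, given by taking preimages. -/
def Spc.comap (F : C ⥤ D) [F.Monoidal] (hF : IsExactFunctor F) : Spc D → Spc C := fun P ↦
  have := P.isTensorIdeal.isStableUnderRetracts
  { ideal := P.ideal.inverseImage F
    isTensorIdeal :=
      { isTriangulated := by
          obtain ⟨_, _⟩ := hF
          have := P.isTensorIdeal.isTriangulated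
          infer_instance
        isStableUnderRetracts :=
          ⟨fun r hY ↦ P.ideal.prop_of_retract (r.map F) hY⟩
        tensor_mem := fun X Y hY ↦ P.ideal.prop_of_iso (Functor.Monoidal.μIso F X Y)
          (P.isTensorIdeal.tensor_mem _ _ hY) }
    proper := ⟨𝟙_ C, fun h ↦ by
      obtain ⟨X, hX⟩ := P.proper
      exact hX (P.ideal.prop_of_iso (ρ_ X) (P.isTensorIdeal.tensor_mem X _
        (P.ideal.prop_of_iso (Functor.Monoidal.εIso F).symm h)))⟩
    prime := fun X Y h ↦ P.prime _ _
      (P.ideal.prop_of_iso (Functor.Monoidal.μIso F X Y).symm h) }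

end Spectrum

section Induced

variable {S D : Type*} [Category* S] [Category* D]
    [HasZeroObject S] [HasShift S ℤ] [Preadditive S]
    [∀ n : ℤ, (shiftFunctor S n).Additive] [Pretriangulated S] [TensorTriangulatedCategory S]
    [HasZeroObject D] [HasShift D ℤ] [Preadditive D]
    [∀ n : ℤ, (shiftFunctor D n).Additive] [Pretriangulated D]

/-- The class of morphisms inverted by a functor. -/
abbrev invertedBy (F : S ⥤ D) : MorphismProperty S :=
  (MorphismProperty.isomorphisms D).inverseImage F

/-- If the kernel of an exact functor is closed under tensoring with arbitrary objects, then the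
class of morphisms which it inverts is compatible with the tensor product. -/
lemma isMonoidal_invertedBy {F : S ⥤ D} (hF : IsExactFunctor F)
    (hK : ∀ X Y : S, IsZero (F.obj Y) → IsZero (F.obj (X ⊗ Y))) :
    (invertedBy F).IsMonoidal where
  whiskerLeft X Y₁ Y₂ g hg := by
    obtain ⟨Z, a, b, hT⟩ := Pretriangulated.distinguished_cocone_triangle g
    have hZ := (hF.isIso_map_iff hT).1 hg
    obtain ⟨_, _⟩ := TensorTriangulatedCategory.exact_tensorLeft X
    exact (hF.isIso_map_iff ((tensorLeft X).map_distinguished _ hT)).2 (hK X Z hZ)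
  whiskerRight {X₁ X₂} f hf Y := by
    obtain ⟨Z, a, b, hT⟩ := Pretriangulated.distinguished_cocone_triangle f
    have hZ := (hF.isIso_map_iff hT).1 hf
    obtain ⟨_, _⟩ := TensorTriangulatedCategory.exact_tensorRight Y
    exact (hF.isIso_map_iff ((tensorRight Y).map_distinguished _ hT)).2
      ((hK Y Z hZ).of_iso (F.mapIso (β_ Z Y)))

variable (F : S ⥤ D) [F.IsLocalization (invertedBy F)] [(invertedBy F).IsMonoidal]

/-- The essentially unique monoidal structure on the target of an exact localization functor `F`
making `F` strong monoidal. Its unit object is the image of the unit object. -/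
noncomputable abbrev inducedMonoidal : MonoidalCategory D :=
  inferInstanceAs (MonoidalCategory
    (LocalizedMonoidal F (invertedBy F) (Iso.refl (F.obj (𝟙_ S)))))

/-- The symmetry of the induced monoidal structure. -/
noncomputable abbrev inducedSymmetric :
    letI := inducedMonoidal F
    SymmetricCategory D :=
  inferInstanceAs (SymmetricCategory
    (LocalizedMonoidal F (invertedBy F) (Iso.refl (F.obj (𝟙_ S)))))

/-- `F` is strong monoidal for the induced monoidal structure. -/
noncomputable abbrev inducedFunctorMonoidal :
    letI := inducedMonoidal F
    F.Monoidal :=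
  inferInstanceAs (Functor.Monoidal (Localization.Monoidal.toMonoidalCategory F (invertedBy F)
    (Iso.refl (F.obj (𝟙_ S)))))

variable {F} in
/-- If the exact localization functor `F` has a fully faithful exact (left or right) adjoint `G`,
then the induced symmetric monoidal structure is a tensor triangulated structure. -/
noncomputable abbrev inducedTensorTriangulated (G : D ⥤ S) (hF : IsExactFunctor F)
    (hG : IsExactFunctor G) (e : G ⋙ F ≅ 𝟭 D) : TensorTriangulatedCategory D :=
  letI := inducedMonoidal F
  letI := inducedSymmetric F
  letI := inducedFunctorMonoidal F
  { exact_tensorLeft := fun X ↦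
      ((hG.comp (TensorTriangulatedCategory.exact_tensorLeft (G.obj X))).comp hF).of_iso
        (NatIso.ofComponents (fun Y ↦ (Functor.Monoidal.μIso F (G.obj X) (G.obj Y)).symm ≪≫
          (e.app X ⊗ᵢ e.app Y)) fun {Y Z} f ↦ by
            have h₁ := Functor.OplaxMonoidal.δ_natural_right F (G.obj X) (G.map f)
            have h₂ := e.hom.naturality f
            dsimp at h₁ h₂
            change F.map (G.obj X ◁ G.map f) ≫ Functor.OplaxMonoidal.δ F _ _ ≫
              (e.hom.app X ⊗ₘ e.hom.app Z) = (Functor.OplaxMonoidal.δ F _ _ ≫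
                (e.hom.app X ⊗ₘ e.hom.app Y)) ≫ X ◁ f
            rw [← reassoc_of% h₁, Category.assoc, ← id_tensorHom, ← id_tensorHom,
              tensorHom_comp_tensorHom, tensorHom_comp_tensorHom, h₂, Category.id_comp]
            erw [Category.comp_id])
    exact_tensorRight := fun X ↦
      ((hG.comp (TensorTriangulatedCategory.exact_tensorRight (G.obj X))).comp hF).of_iso
        (NatIso.ofComponents (fun Y ↦ (Functor.Monoidal.μIso F (G.obj Y) (G.obj X)).symm ≪≫
          (e.app Y ⊗ᵢ e.app X)) fun {Y Z} f ↦ by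
            have h₁ := Functor.OplaxMonoidal.δ_natural_left F (G.map f) (G.obj X)
            have h₂ := e.hom.naturality f
            dsimp at h₁ h₂
            change F.map (G.map f ▷ G.obj X) ≫ Functor.OplaxMonoidal.δ F _ _ ≫
              (e.hom.app Z ⊗ₘ e.hom.app X) = (Functor.OplaxMonoidal.δ F _ _ ≫
                (e.hom.app Y ⊗ₘ e.hom.app X)) ≫ f ▷ X
            rw [← reassoc_of% h₁, Category.assoc, ← tensorHom_id, ← tensorHom_id,
              tensorHom_comp_tensorHom, tensorHom_comp_tensorHom, h₂, Category.id_comp]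
            erw [Category.comp_id]) }

end Induced

section LocalisationSequence

variable {R S T : Type*} [Category* R] [Category* S] [Category* T]
    [HasZeroObject R] [HasShift R ℤ] [Preadditive R]
    [∀ n : ℤ, (shiftFunctor R n).Additive] [Pretriangulated R]
    [HasZeroObject S] [HasShift S ℤ] [Preadditive S]
    [∀ n : ℤ, (shiftFunctor S n).Additive] [Pretriangulated S]
    [HasZeroObject T] [HasShift T ℤ] [Preadditive T]
    [∀ n : ℤ, (shiftFunctor T n).Additive] [Pretriangulated T]

/-- A localisation sequence `R ⇄ S ⇄ T`: the functors `iIncl : R ⥤ S` and `jIncl : T ⥤ S` are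
fully faithful and exact, `iRight` is right adjoint to `iIncl`, `jLeft` is left adjoint to
`jIncl`, and the essential images of `iIncl` and `jIncl` are the orthogonals of each other. -/
structure LocalisationSequence (iIncl : R ⥤ S) (iRight : S ⥤ R) (jLeft : S ⥤ T)
    (jIncl : T ⥤ S) where
  full_i : iIncl.Full
  faithful_i : iIncl.Faithful
  exact_i : IsExactFunctor iIncl
  full_j : jIncl.Full
  faithful_j : jIncl.Faithful
  exact_j : IsExactFunctor jIncl
  /-- `iRight` is right adjoint to `iIncl` -/
  adj_i : iIncl ⊣ iRight
  /-- `jLeft` is left adjoint to `jIncl` -/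
  adj_j : jLeft ⊣ jIncl
  rightOrthogonal_i : iIncl.essImage.rightOrthogonal = jIncl.essImage
  leftOrthogonal_j : iIncl.essImage = jIncl.essImage.leftOrthogonal

namespace LocalisationSequence

variable {iIncl : R ⥤ S} {iRight : S ⥤ R} {jLeft : S ⥤ T} {jIncl : T ⥤ S}

lemma exact_iRight (h : LocalisationSequence iIncl iRight jLeft jIncl) :
    IsExactFunctor iRight := h.exact_i.rightAdjoint h.adj_i

lemma exact_jLeft (h : LocalisationSequence iIncl iRight jLeft jIncl) :
    IsExactFunctor jLeft := h.exact_j.leftAdjoint h.adj_j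

lemma isZero_iRight_obj_iff (h : LocalisationSequence iIncl iRight jLeft jIncl)
    (X : S) : IsZero (iRight.obj X) ↔ jIncl.essImage X := by
  rw [← h.rightOrthogonal_i]
  constructor
  · rintro hX Y f ⟨Z, ⟨e⟩⟩
    have : e.hom ≫ f = 0 := (h.adj_i.homEquiv Z X).injective (hX.eq_of_tgt _ _)
    simpa using this
  · intro hX
    rw [IsZero.iff_id_eq_zero]
    have := h.faithful_i
    apply (h.adj_i.homEquiv _ _).symm.injective
    rw [hX ((h.adj_i.homEquiv _ _).symm _) (iIncl.obj_mem_essImage _),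
      hX ((h.adj_i.homEquiv _ _).symm _) (iIncl.obj_mem_essImage _)]

lemma isZero_jLeft_obj_iff (h : LocalisationSequence iIncl iRight jLeft jIncl)
    (X : S) : IsZero (jLeft.obj X) ↔ iIncl.essImage X := by
  rw [h.leftOrthogonal_j]
  constructor
  · rintro hX Y f ⟨Z, ⟨e⟩⟩
    have : f ≫ e.inv = 0 := (h.adj_j.homEquiv X Z).symm.injective (hX.eq_of_src _ _)
    simpa using this
  · intro hX
    rw [IsZero.iff_id_eq_zero]
    apply (h.adj_j.homEquiv _ _).injective
    rw [hX (h.adj_j.homEquiv _ _ _) (jIncl.obj_mem_essImage _),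
      hX (h.adj_j.homEquiv _ _ _) (jIncl.obj_mem_essImage _)]

lemma isLocalization_iRight (h : LocalisationSequence iIncl iRight jLeft jIncl) :
    iRight.IsLocalization (invertedBy iRight) :=
  have := h.full_i
  have := h.faithful_i
  h.adj_i.isLocalization'

lemma isLocalization_jLeft (h : LocalisationSequence iIncl iRight jLeft jIncl) :
    jLeft.IsLocalization (invertedBy jLeft) :=
  have := h.full_j
  have := h.faithful_j
  h.adj_j.isLocalization

variable [TensorTriangulatedCategory S]

lemma isMonoidal_iRight (h : LocalisationSequence iIncl iRight jLeft jIncl)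
    (hT : IsTensorIdeal jIncl.essImage) :
    (invertedBy iRight).IsMonoidal :=
  isMonoidal_invertedBy h.exact_iRight fun X Y hY ↦ (h.isZero_iRight_obj_iff _).2
    (hT.tensor_mem X Y ((h.isZero_iRight_obj_iff _).1 hY))

lemma isMonoidal_jLeft (h : LocalisationSequence iIncl iRight jLeft jIncl)
    (hR : IsTensorIdeal iIncl.essImage) :
    (invertedBy jLeft).IsMonoidal :=
  isMonoidal_invertedBy h.exact_jLeft fun X Y hY ↦ (h.isZero_jLeft_obj_iff _).2
    (hR.tensor_mem X Y ((h.isZero_jLeft_obj_iff _).1 hY))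

/-- If `R` and `T` are tensor ideals of `S`, then `R` is a tensor triangulated category, with the
tensor product of `S` and with the image under `iRight` of the unit of `S` as unit. -/
noncomputable abbrev tensorTriangulatedR (h : LocalisationSequence iIncl iRight jLeft jIncl)
    (hT : IsTensorIdeal jIncl.essImage) :
    TensorTriangulatedCategory R :=
  haveI := h.isLocalization_iRight
  haveI := h.isMonoidal_iRight hT
  haveI := h.full_i
  haveI := h.faithful_i
  inducedTensorTriangulated iIncl h.exact_iRight h.exact_i (asIso h.adj_i.unit).symm

/-- If `R` and `T` are tensor ideals of `S`, then `T` is a tensor triangulated category, with the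
tensor product of `S` and with the image under `jLeft` of the unit of `S` as unit. -/
noncomputable abbrev tensorTriangulatedT (h : LocalisationSequence iIncl iRight jLeft jIncl)
    (hR : IsTensorIdeal iIncl.essImage) :
    TensorTriangulatedCategory T :=
  haveI := h.isLocalization_jLeft
  haveI := h.isMonoidal_jLeft hR
  haveI := h.full_j
  haveI := h.faithful_j
  inducedTensorTriangulated jIncl h.exact_jLeft h.exact_j (asIso h.adj_j.counit)

/-- The spectrum of `R`. -/
abbrev SpcR (h : LocalisationSequence iIncl iRight jLeft jIncl)
    (hT : IsTensorIdeal jIncl.essImage) : Type _ :=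
  letI := h.tensorTriangulatedR hT
  Spc R

/-- The spectrum of `T`. -/
abbrev SpcT (h : LocalisationSequence iIncl iRight jLeft jIncl)
    (hR : IsTensorIdeal iIncl.essImage) : Type _ :=
  letI := h.tensorTriangulatedT hR
  Spc T

/-- The map of spectra `Spc R → Spc S` induced by the strong monoidal exact functor `iRight`. -/
noncomputable def spcMapR (h : LocalisationSequence iIncl iRight jLeft jIncl)
    (hT : IsTensorIdeal jIncl.essImage) : h.SpcR hT → Spc S :=
  letI := h.tensorTriangulatedR hT
  haveI := h.isLocalization_iRight
  haveI := h.isMonoidal_iRight hT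
  letI : iRight.Monoidal := inducedFunctorMonoidal iRight
  Spc.comap iRight h.exact_iRight

/-- The map of spectra `Spc T → Spc S` induced by the strong monoidal exact functor `jLeft`. -/
noncomputable def spcMapT (h : LocalisationSequence iIncl iRight jLeft jIncl)
    (hR : IsTensorIdeal iIncl.essImage) : h.SpcT hR → Spc S :=
  letI := h.tensorTriangulatedT hR
  haveI := h.isLocalization_jLeft
  haveI := h.isMonoidal_jLeft hR
  letI : jLeft.Monoidal := inducedFunctorMonoidal jLeft
  Spc.comap jLeft h.exact_jLeft

end LocalisationSequence

end LocalisationSequence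

/-! Both halves of the sequence have the same shape: a strong monoidal exact functor `F` with a
section `G` (so `G ⋙ F ≅ 𝟭`) whose essential image is a tensor ideal. For `Y` in that image there is
a projection formula `G (F X) ⊗ Y ≅ X ⊗ Y`, since both sides lie in the image and agree under `F`.
If a prime `Q` omits such a `Y`, cancelling `Y` gives `G (F X) ∈ Q ↔ X ∈ Q` (`Spc.ideal_map_iff`).
Hence `Q` is the pullback of its restriction along `G`, and the range of `comap F` is the support of
the image of `G`. This support is the closed set `supp (G (F 𝟙))`.

The two supports are complementary. They are disjoint because the product of an object of `R` and
one of `T` lies in both ideals, so it is zero; they cover because every object is an extension of an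
object of `T` by one of `R`, so no proper `Q` contains both ideals. Two complementary closed sets
are clopen.

For disconnectedness, each ideal is proper when the other is nonzero, and a proper ideal lies in a
prime (`IsTensorIdeal.exists_le_prime`), so neither support is the whole spectrum. -/

section TensorIdeals

variable {C : Type*} [Category* C]
    [HasZeroObject C] [HasShift C ℤ] [Preadditive C]
    [∀ n : ℤ, (shiftFunctor C n).Additive] [Pretriangulated C] [TensorTriangulatedCategory C]

/-! ### Tensor ideals and the existence of primes -/

namespace IsTensorIdeal

variable {P : ObjectProperty C}

lemma prop_of_iso (hP : IsTensorIdeal P) {X Y : C} (e : X ≅ Y) (hX : P X) : P Y :=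
  have := hP.isStableUnderRetracts
  P.prop_of_iso e hX

lemma prop_iff_of_iso (hP : IsTensorIdeal P) {X Y : C} (e : X ≅ Y) : P X ↔ P Y :=
  ⟨hP.prop_of_iso e, hP.prop_of_iso e.symm⟩

lemma tensor_mem_left (hP : IsTensorIdeal P) (X Y : C) (hX : P X) : P (X ⊗ Y) :=
  hP.prop_of_iso (β_ Y X) (hP.tensor_mem Y X hX)

lemma prop_of_isZero (hP : IsTensorIdeal P) {X : C} (hX : IsZero X) : P X := by
  have := hP.isTriangulated
  obtain ⟨Z, hZ, h⟩ := P.exists_prop_of_containsZero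
  exact hP.prop_of_iso (hZ.iso hX) h

lemma prop_of_unit (hP : IsTensorIdeal P) (h : P (𝟙_ C)) (X : C) : P X :=
  hP.prop_of_iso (ρ_ X) (hP.tensor_mem X _ h)

lemma prop₂ (hP : IsTensorIdeal P) {T : Pretriangulated.Triangle C}
    (hT : T ∈ Pretriangulated.distinguishedTriangles) (h₁ : P T.obj₁) (h₃ : P T.obj₃) :
    P T.obj₂ := by
  have := hP.isTriangulated
  have := hP.isStableUnderRetracts
  exact P.ext_of_isTriangulatedClosed₂ T hT h₁ h₃

/-- The objects whose tensor product with `Y` lies in a given tensor ideal form a tensor ideal. -/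
lemma inverseImage_tensorRight (hP : IsTensorIdeal P) (Y : C) :
    IsTensorIdeal (P.inverseImage (tensorRight Y)) where
  isTriangulated := by
    obtain ⟨_, _⟩ := TensorTriangulatedCategory.exact_tensorRight Y
    have := hP.isTriangulated
    have := hP.isStableUnderRetracts
    infer_instance
  isStableUnderRetracts :=
    have := hP.isStableUnderRetracts
    ⟨fun r hY ↦ P.prop_of_retract (r.map (tensorRight Y)) hY⟩
  tensor_mem A B hB := hP.prop_of_iso (α_ A B Y).symm (hP.tensor_mem A _ hB)

/-- The union of a non-empty chain of tensor ideals is a tensor ideal. -/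
lemma sUnion_of_isChain {c : Set (ObjectProperty C)} (hc : IsChain (· ≤ ·) c)
    (hne : c.Nonempty) (h : ∀ P ∈ c, IsTensorIdeal P) :
    IsTensorIdeal (fun X ↦ ∃ P ∈ c, P X : ObjectProperty C) where
  isTriangulated :=
    { exists_zero := by
        obtain ⟨P, hP⟩ := hne
        have := (h P hP).isTriangulated
        obtain ⟨Z, hZ, hPZ⟩ := P.exists_prop_of_containsZero
        exact ⟨Z, hZ, P, hP, hPZ⟩
      isStableUnderShiftBy := fun n ↦ ⟨by
        rintro X ⟨P, hP, hX⟩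
        have := (h P hP).isTriangulated
        exact ⟨P, hP, P.le_shift n _ hX⟩⟩
      ext₂' := by
        rintro T hT ⟨P, hP, h₁⟩ ⟨Q, hQ, h₃⟩
        refine ObjectProperty.le_isoClosure _ _ ?_
        obtain hPQ | hQP := hc.total hP hQ
        · exact ⟨Q, hQ, (h Q hQ).prop₂ hT (hPQ _ h₁) h₃⟩
        · exact ⟨P, hP, (h P hP).prop₂ hT h₁ (hQP _ h₃)⟩ }
  isStableUnderRetracts := ⟨by
    rintro X Y r ⟨P, hP, hY⟩
    have := (h P hP).isStableUnderRetracts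
    exact ⟨P, hP, P.prop_of_retract r hY⟩⟩
  tensor_mem := by
    rintro X Y ⟨P, hP, hY⟩
    exact ⟨P, hP, (h P hP).tensor_mem X Y hY⟩

/-- Every proper tensor ideal is contained in a prime one. -/
lemma exists_le_prime (hP : IsTensorIdeal P) (hP' : ∃ X : C, ¬ P X) :
    ∃ Q : Spc C, P ≤ Q.ideal := by
  -- Properness is phrased as omitting the unit, a condition that passes to unions of chains.
  obtain ⟨M, hPM, hM⟩ := zorn_le_nonempty₀ {I : ObjectProperty C | IsTensorIdeal I ∧ ¬ I (𝟙_ C)}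
    (fun c hc hchain I hI ↦ ⟨fun X ↦ ∃ J ∈ c, J X,
      ⟨sUnion_of_isChain hchain ⟨I, hI⟩ fun J hJ ↦ (hc hJ).1,
        fun ⟨J, hJ, h⟩ ↦ (hc hJ).2 h⟩, fun J hJ X hX ↦ ⟨J, hJ, hX⟩⟩) P
    ⟨hP, fun h ↦ hP'.elim fun X hX ↦ hX (hP.prop_of_unit h X)⟩
  obtain ⟨hMI, hM1⟩ := hM.prop
  refine ⟨⟨M, hMI, ⟨_, hM1⟩, fun X Y hXY ↦ ?_⟩, hPM⟩
  by_contra! hn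
  -- The ideal `{Z | Z ⊗ Y ∈ M}` contains `M` and, as `Y ∉ M`, omits the unit. By maximality it is
  -- contained in `M`, yet it contains `X`.
  refine hn.1 (hM.le_of_ge ⟨hMI.inverseImage_tensorRight Y, fun h ↦ ?_⟩ ?_ X hXY)
  · exact hn.2 (hMI.prop_of_iso (λ_ Y) h)
  · exact fun Z hZ ↦ hMI.tensor_mem_left Z Y hZ

end IsTensorIdeal

namespace Spc

lemma ext_ideal {P Q : Spc C} (h : P.ideal = Q.ideal) : P = Q := by
  cases P; cases Q; cases h; rfl

lemma mem_suppOf {A : ObjectProperty C} {P : Spc C} :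
    P ∈ suppOf A ↔ ∃ X, A X ∧ ¬ P.ideal X := by
  simp [suppOf, supp]

lemma isClosed_supp (X : C) : IsClosed (supp X) :=
  ⟨TopologicalSpace.isOpen_generateFrom_of_mem ⟨X, rfl⟩⟩

lemma ideal_tensor_iff (P : Spc C) {X Y : C} (hY : ¬ P.ideal Y) :
    P.ideal (X ⊗ Y) ↔ P.ideal X :=
  ⟨fun h ↦ (P.prime X Y h).resolve_right hY, P.isTensorIdeal.tensor_mem_left X Y⟩

/-- The support of a proper tensor ideal does not exhaust the spectrum. -/
lemma suppOf_ne_univ {A : ObjectProperty C} (hA : IsTensorIdeal A) (hA' : ∃ X, ¬ A X) :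
    suppOf A ≠ Set.univ := by
  obtain ⟨Q, hQ⟩ := hA.exists_le_prime hA'
  intro h
  obtain ⟨X, hX, hX'⟩ := mem_suppOf.1 (h.symm ▸ Set.mem_univ Q : Q ∈ suppOf A)
  exact hX' (hQ X hX)

end Spc

end TensorIdeals

/-! ### Spectra along a strong monoidal functor with a section onto a tensor ideal -/

section Comap

variable {C D : Type*} [Category* C] [Category* D]
    [HasZeroObject C] [HasShift C ℤ] [Preadditive C]
    [∀ n : ℤ, (shiftFunctor C n).Additive] [Pretriangulated C] [TensorTriangulatedCategory C]
    [HasZeroObject D] [HasShift D ℤ] [Preadditive D]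
    [∀ n : ℤ, (shiftFunctor D n).Additive] [Pretriangulated D] [TensorTriangulatedCategory D]
    {F : C ⥤ D} [F.Monoidal] {G : D ⥤ C}

/-- Two objects in the essential image of a section of `F` are isomorphic as soon as their images
under `F` are. -/
lemma nonempty_iso_of_essImage {C D : Type*} [Category* C] [Category* D] {F : C ⥤ D} {G : D ⥤ C}
    (e : G ⋙ F ≅ 𝟭 D) {X Y : C} (hX : G.essImage X) (hY : G.essImage Y)
    (i : F.obj X ≅ F.obj Y) : Nonempty (X ≅ Y) := by
  obtain ⟨X', ⟨x⟩⟩ := hX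
  obtain ⟨Y', ⟨y⟩⟩ := hY
  exact ⟨x.symm ≪≫ G.mapIso ((e.app X').symm ≪≫ F.mapIso x ≪≫ i ≪≫ F.mapIso y.symm ≪≫
    e.app Y') ≪≫ y⟩

/-- Being an ideal puts `G X ⊗ G Y` in the image of `G`, where `F` detects isomorphism. Mere
existence suffices, since membership in an ideal is invariant under isomorphism. -/
lemma nonempty_iso_map_tensor (e : G ⋙ F ≅ 𝟭 D) (hA : IsTensorIdeal G.essImage) (X Y : D) :
    Nonempty (G.obj (X ⊗ Y) ≅ G.obj X ⊗ G.obj Y) :=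
  nonempty_iso_of_essImage e (G.obj_mem_essImage _) (hA.tensor_mem _ _ (G.obj_mem_essImage _))
    (e.app (X ⊗ Y) ≪≫ ((e.app X).symm ⊗ᵢ (e.app Y).symm) ≪≫
      Functor.Monoidal.μIso F (G.obj X) (G.obj Y))

/-- The projection formula: `F` identifies both sides with `F X ⊗ F Y`, and tensoring with `Y` lands
in the image of `G`. -/
lemma nonempty_iso_tensor_of_essImage (e : G ⋙ F ≅ 𝟭 D) (hA : IsTensorIdeal G.essImage)
    (X : C) {Y : C} (hY : G.essImage Y) :
    Nonempty (G.obj (F.obj X) ⊗ Y ≅ X ⊗ Y) :=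
  nonempty_iso_of_essImage e (hA.tensor_mem _ _ hY) (hA.tensor_mem _ _ hY)
    ((Functor.Monoidal.μIso F _ Y).symm ≪≫ (e.app (F.obj X) ⊗ᵢ Iso.refl (F.obj Y)) ≪≫
      Functor.Monoidal.μIso F X Y)

namespace Spc

lemma ideal_map_iff (e : G ⋙ F ≅ 𝟭 D) (hA : IsTensorIdeal G.essImage) {Q : Spc C}
    (hQ : Q ∈ suppOf G.essImage) (X : C) :
    Q.ideal (G.obj (F.obj X)) ↔ Q.ideal X := by
  obtain ⟨Y, hY, hQY⟩ := mem_suppOf.1 hQ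
  obtain ⟨i⟩ := nonempty_iso_tensor_of_essImage e hA X hY
  rw [← Q.ideal_tensor_iff hQY, Q.isTensorIdeal.prop_iff_of_iso i, Q.ideal_tensor_iff hQY]

/-- A prime tensor ideal which does not contain the image of the section `G` of `F` restricts
along `G` to a prime tensor ideal. -/
def restrict (e : G ⋙ F ≅ 𝟭 D) (hG : IsExactFunctor G) (hA : IsTensorIdeal G.essImage)
    (Q : Spc C) (hQ : Q ∈ suppOf G.essImage) : Spc D where
  ideal := Q.ideal.inverseImage G
  isTensorIdeal :=
    have := Q.isTensorIdeal.isStableUnderRetracts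
    { isTriangulated := by
        obtain ⟨_, _⟩ := hG
        have := Q.isTensorIdeal.isTriangulated
        infer_instance
      isStableUnderRetracts := ⟨fun r hY ↦ Q.ideal.prop_of_retract (r.map G) hY⟩
      tensor_mem := fun X Y hY ↦ by
        obtain ⟨i⟩ := nonempty_iso_map_tensor e hA X Y
        exact Q.isTensorIdeal.prop_of_iso i.symm (Q.isTensorIdeal.tensor_mem _ _ hY) }
  proper := by
    obtain ⟨Y, ⟨Z, ⟨z⟩⟩, hQY⟩ := mem_suppOf.1 hQ
    exact ⟨Z, fun h ↦ hQY (Q.isTensorIdeal.prop_of_iso z h)⟩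
  prime X Y h := by
    obtain ⟨i⟩ := nonempty_iso_map_tensor e hA X Y
    exact Q.prime _ _ (Q.isTensorIdeal.prop_of_iso i h)

/-- If a prime omits `X`, its pullback omits `G X`. Conversely, `ideal_map_iff` says that `Q` is the
pullback of `restrict Q`. -/
lemma range_comap (hF : IsExactFunctor F) (e : G ⋙ F ≅ 𝟭 D) (hG : IsExactFunctor G)
    (hA : IsTensorIdeal G.essImage) :
    Set.range (comap F hF) = suppOf G.essImage := by
  ext Q
  constructor
  · rintro ⟨P, rfl⟩
    obtain ⟨X, hX⟩ := P.proper
    exact mem_suppOf.2 ⟨G.obj X, G.obj_mem_essImage X,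
      fun h ↦ hX (P.isTensorIdeal.prop_of_iso (e.app X) h)⟩
  · exact fun hQ ↦ ⟨restrict e hG hA Q hQ,
      ext_ideal (funext fun X ↦ propext (ideal_map_iff e hA hQ X))⟩

lemma preimage_comap_supp (hF : IsExactFunctor F) (X : C) :
    comap F hF ⁻¹' supp X = supp (F.obj X) := rfl

lemma supp_eq_of_iso {X Y : C} (i : X ≅ Y) : supp X = supp Y :=
  Set.ext fun P ↦ not_congr (P.isTensorIdeal.prop_iff_of_iso i)

/-- Since `F (G X) ≅ X`, a prime is recovered from its pullback by testing on the objects `G X`, and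
`supp X` is the preimage of `supp (G X)`. -/
lemma isEmbedding_comap (hF : IsExactFunctor F) (e : G ⋙ F ≅ 𝟭 D) :
    IsEmbedding (comap F hF) where
  injective P P' h := ext_ideal (funext fun X ↦ propext (by
    have hX : (comap F hF P).ideal (G.obj X) ↔ (comap F hF P').ideal (G.obj X) := by rw [h]
    exact (P.isTensorIdeal.prop_iff_of_iso (e.app X)).symm.trans
      (hX.trans (P'.isTensorIdeal.prop_iff_of_iso (e.app X)))))
  eq_induced := by
    simp only [instTopologicalSpace]
    rw [induced_generateFrom_eq]
    congr 1
    ext U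
    constructor
    · rintro ⟨X, rfl⟩
      refine ⟨(supp (G.obj X))ᶜ, ⟨_, rfl⟩, ?_⟩
      rw [Set.preimage_compl, preimage_comap_supp]
      exact congrArg _ (supp_eq_of_iso (e.app X))
    · rintro ⟨_, ⟨X, rfl⟩, rfl⟩
      exact ⟨F.obj X, rfl⟩

lemma isClosed_suppOf_essImage (e : G ⋙ F ≅ 𝟭 D) (hA : IsTensorIdeal G.essImage) :
    IsClosed (suppOf (C := C) G.essImage) := by
  -- One object computes the whole support: a prime in it containing `G (F 𝟙)` would contain the
  -- unit.
  have : suppOf G.essImage = supp (G.obj (F.obj (𝟙_ C))) := by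
    ext Q
    constructor
    · intro hQ h
      obtain ⟨X, hX⟩ := Q.proper
      exact hX (Q.isTensorIdeal.prop_of_unit ((ideal_map_iff e hA hQ _).1 h) X)
    · exact fun h ↦ mem_suppOf.2 ⟨_, G.obj_mem_essImage _, h⟩
  rw [this]
  exact isClosed_supp _

end Spc

end Comap

/-! ### The two halves of a localisation sequence -/

namespace LocalisationSequence

variable {R S T : Type*} [Category* R] [Category* S] [Category* T]
    [HasZeroObject R] [HasShift R ℤ] [Preadditive R]
    [∀ n : ℤ, (shiftFunctor R n).Additive] [Pretriangulated R]
    [HasZeroObject S] [HasShift S ℤ] [Preadditive S]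
    [∀ n : ℤ, (shiftFunctor S n).Additive] [Pretriangulated S]
    [HasZeroObject T] [HasShift T ℤ] [Preadditive T]
    [∀ n : ℤ, (shiftFunctor T n).Additive] [Pretriangulated T]
    {iIncl : R ⥤ S} {iRight : S ⥤ R} {jLeft : S ⥤ T} {jIncl : T ⥤ S}

lemma isZero_of_essImage (h : LocalisationSequence iIncl iRight jLeft jIncl) {X : S}
    (hi : iIncl.essImage X) (hj : jIncl.essImage X) : IsZero X := by
  rw [← h.rightOrthogonal_i] at hj
  exact (IsZero.iff_id_eq_zero X).2 (hj (𝟙 X) hi)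

/-- Every object of `S` is an extension of an object in the image of `T` by one in the image
of `R`. -/
lemma exists_triangle (h : LocalisationSequence iIncl iRight jLeft jIncl) (X : S) :
    ∃ A : Pretriangulated.Triangle S, A ∈ Pretriangulated.distinguishedTriangles ∧
      iIncl.essImage A.obj₁ ∧ A.obj₂ = X ∧ jIncl.essImage A.obj₃ := by
  have := h.full_i
  have := h.faithful_i
  obtain ⟨Z, a, b, hT⟩ := Pretriangulated.distinguished_cocone_triangle (h.adj_i.counit.app X)
  refine ⟨_, hT, iIncl.obj_mem_essImage _, rfl, (h.isZero_iRight_obj_iff Z).1 ?_⟩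
  -- As `iIncl` is fully faithful, `iRight` inverts the counit, so it kills the cone; its kernel is
  -- the image of `T`.
  exact (h.exact_iRight.isIso_map_iff hT).1 (inferInstanceAs (IsIso (iRight.map (h.adj_i.counit.app X))))

variable [TensorTriangulatedCategory S]

/-- The section isomorphism is the inverse of the unit here, and the counit for `T`, because
`iRight` is a right adjoint and `jLeft` a left adjoint. -/
lemma isEmbedding_spcMapR (h : LocalisationSequence iIncl iRight jLeft jIncl)
    (hT : IsTensorIdeal jIncl.essImage) : IsEmbedding (h.spcMapR hT) :=
  letI := h.tensorTriangulatedR hT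
  haveI := h.isLocalization_iRight
  haveI := h.isMonoidal_iRight hT
  haveI := h.full_i
  haveI := h.faithful_i
  letI : iRight.Monoidal := inducedFunctorMonoidal iRight
  Spc.isEmbedding_comap h.exact_iRight (asIso h.adj_i.unit).symm

lemma isEmbedding_spcMapT (h : LocalisationSequence iIncl iRight jLeft jIncl)
    (hR : IsTensorIdeal iIncl.essImage) : IsEmbedding (h.spcMapT hR) :=
  letI := h.tensorTriangulatedT hR
  haveI := h.isLocalization_jLeft
  haveI := h.isMonoidal_jLeft hR
  haveI := h.full_j
  haveI := h.faithful_j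
  letI : jLeft.Monoidal := inducedFunctorMonoidal jLeft
  Spc.isEmbedding_comap h.exact_jLeft (asIso h.adj_j.counit)

lemma range_spcMapR (h : LocalisationSequence iIncl iRight jLeft jIncl)
    (hR : IsTensorIdeal iIncl.essImage) (hT : IsTensorIdeal jIncl.essImage) :
    Set.range (h.spcMapR hT) = Spc.suppOf iIncl.essImage :=
  letI := h.tensorTriangulatedR hT
  haveI := h.isLocalization_iRight
  haveI := h.isMonoidal_iRight hT
  haveI := h.full_i
  haveI := h.faithful_i
  letI : iRight.Monoidal := inducedFunctorMonoidal iRight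
  Spc.range_comap h.exact_iRight (asIso h.adj_i.unit).symm h.exact_i hR

lemma range_spcMapT (h : LocalisationSequence iIncl iRight jLeft jIncl)
    (hR : IsTensorIdeal iIncl.essImage) (hT : IsTensorIdeal jIncl.essImage) :
    Set.range (h.spcMapT hR) = Spc.suppOf jIncl.essImage :=
  letI := h.tensorTriangulatedT hR
  haveI := h.isLocalization_jLeft
  haveI := h.isMonoidal_jLeft hR
  haveI := h.full_j
  haveI := h.faithful_j
  letI : jLeft.Monoidal := inducedFunctorMonoidal jLeft
  Spc.range_comap h.exact_jLeft (asIso h.adj_j.counit) h.exact_j hT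

lemma isClosed_suppOf_iIncl (h : LocalisationSequence iIncl iRight jLeft jIncl)
    (hR : IsTensorIdeal iIncl.essImage) (hT : IsTensorIdeal jIncl.essImage) :
    IsClosed (Spc.suppOf iIncl.essImage) :=
  letI := h.tensorTriangulatedR hT
  haveI := h.isLocalization_iRight
  haveI := h.isMonoidal_iRight hT
  haveI := h.full_i
  haveI := h.faithful_i
  letI : iRight.Monoidal := inducedFunctorMonoidal iRight
  Spc.isClosed_suppOf_essImage (asIso h.adj_i.unit).symm hR

lemma isClosed_suppOf_jIncl (h : LocalisationSequence iIncl iRight jLeft jIncl)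
    (hR : IsTensorIdeal iIncl.essImage) (hT : IsTensorIdeal jIncl.essImage) :
    IsClosed (Spc.suppOf jIncl.essImage) :=
  letI := h.tensorTriangulatedT hR
  haveI := h.isLocalization_jLeft
  haveI := h.isMonoidal_jLeft hR
  haveI := h.full_j
  haveI := h.faithful_j
  letI : jLeft.Monoidal := inducedFunctorMonoidal jLeft
  Spc.isClosed_suppOf_essImage (asIso h.adj_j.counit) hT

lemma isCompl_suppOf (h : LocalisationSequence iIncl iRight jLeft jIncl)
    (hR : IsTensorIdeal iIncl.essImage) (hT : IsTensorIdeal jIncl.essImage) :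
    IsCompl (Spc.suppOf iIncl.essImage) (Spc.suppOf jIncl.essImage) := by
  refine ⟨Set.disjoint_left.2 fun Q hQR hQT ↦ ?_,
    codisjoint_iff.2 (Set.eq_univ_of_forall fun Q ↦ ?_)⟩
  · obtain ⟨X, hX, hQX⟩ := Spc.mem_suppOf.1 hQR
    obtain ⟨Y, hY, hQY⟩ := Spc.mem_suppOf.1 hQT
    exact (Q.prime X Y (Q.isTensorIdeal.prop_of_isZero (h.isZero_of_essImage
      (hR.tensor_mem_left X Y hX) (hT.tensor_mem X Y hY)))).elim hQX hQY
  · by_contra hQ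
    have hQ' : (∀ X, iIncl.essImage X → Q.ideal X) ∧ ∀ X, jIncl.essImage X → Q.ideal X := by
      simpa [Spc.mem_suppOf, not_or] using hQ
    obtain ⟨X, hX⟩ := Q.proper
    obtain ⟨A, hA, h₁, rfl, h₃⟩ := h.exists_triangle X
    exact hX (Q.isTensorIdeal.prop₂ hA (hQ'.1 _ h₁) (hQ'.2 _ h₃))

end LocalisationSequence

theorem mainTheorem8
    {R : Type u₁} {S : Type u₂} {T : Type u₃}
    [Category.{v₁} R] [Category.{v₂} S] [Category.{v₃} T]
    [HasZeroObject R] [HasShift R ℤ] [Preadditive R]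
    [∀ n : ℤ, (shiftFunctor R n).Additive] [Pretriangulated R] [IsTriangulated R]
    [HasZeroObject S] [HasShift S ℤ] [Preadditive S]
    [∀ n : ℤ, (shiftFunctor S n).Additive] [Pretriangulated S] [IsTriangulated S]
    [HasZeroObject T] [HasShift T ℤ] [Preadditive T]
    [∀ n : ℤ, (shiftFunctor T n).Additive] [Pretriangulated T] [IsTriangulated T]
    [EssentiallySmall.{w} S] [TensorTriangulatedCategory S]
    {iIncl : R ⥤ S} {iRight : S ⥤ R} {jLeft : S ⥤ T} {jIncl : T ⥤ S}
    (h : LocalisationSequence iIncl iRight jLeft jIncl)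
    (hR : IsTensorIdeal iIncl.essImage) (hT : IsTensorIdeal jIncl.essImage) :
    (IsEmbedding (h.spcMapR hT) ∧
      Set.range (h.spcMapR hT) = Spc.suppOf iIncl.essImage ∧
      IsOpen (Spc.suppOf iIncl.essImage) ∧ IsClosed (Spc.suppOf iIncl.essImage)) ∧
    (IsEmbedding (h.spcMapT hR) ∧
      Set.range (h.spcMapT hR) = Spc.suppOf jIncl.essImage ∧
      IsOpen (Spc.suppOf jIncl.essImage) ∧ IsClosed (Spc.suppOf jIncl.essImage)) ∧
    (Disjoint (Set.range (h.spcMapR hT)) (Set.range (h.spcMapT hR)) ∧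
      Set.range (h.spcMapR hT) ∪ Set.range (h.spcMapT hR) = Set.univ ∧
      IsHomeomorph (Sum.elim (h.spcMapR hT) (h.spcMapT hR))) ∧
    ((∃ X : R, ¬ IsZero X) → (∃ Y : T, ¬ IsZero Y) → ¬ PreconnectedSpace (Spc S)) := by
  have hc := h.isCompl_suppOf hR hT
  have hcR := h.isClosed_suppOf_iIncl hR hT
  have hcT := h.isClosed_suppOf_jIncl hR hT
  have hoR : IsOpen (Spc.suppOf iIncl.essImage) := hc.symm.compl_eq ▸ hcT.isOpen_compl
  have hoT : IsOpen (Spc.suppOf jIncl.essImage) := hc.compl_eq ▸ hcR.isOpen_compl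
  have heR := h.isEmbedding_spcMapR hT
  have heT := h.isEmbedding_spcMapT hR
  have hrR := h.range_spcMapR hR hT
  have hrT := h.range_spcMapT hR hT
  refine ⟨⟨heR, hrR, hoR, hcR⟩, ⟨heT, hrT, hoT, hcT⟩, ⟨?_, ?_, ?_⟩, ?_⟩
  · rw [hrR, hrT]
    exact hc.disjoint
  · rw [hrR, hrT]
    exact hc.sup_eq_top
  · refine ⟨heR.continuous.sumElim heT.continuous,
      isOpenMap_sumElim.2 ⟨heR.isOpenMap (hrR ▸ hoR), heT.isOpenMap (hrT ▸ hoT)⟩,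
      heR.injective.sumElim heT.injective fun P Q hPQ ↦ ?_, ?_⟩
    · exact Set.disjoint_left.1 hc.disjoint (hrR ▸ Set.mem_range_self P)
        (hPQ ▸ hrT ▸ Set.mem_range_self Q)
    · rw [← Set.range_eq_univ, Set.Sum.elim_range, hrR, hrT]
      exact hc.sup_eq_top
  · rintro ⟨X, hX⟩ ⟨Y, hY⟩ _
    have := h.full_i
    have := h.faithful_i
    have := h.full_j
    have := h.faithful_j
    -- The witness of properness is `jIncl.obj Y`: were it in the image of `R`, `jLeft` would kill
    -- it, forcing `Y` to be zero.
    have hnR : Spc.suppOf iIncl.essImage ≠ Set.univ :=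
      Spc.suppOf_ne_univ hR ⟨jIncl.obj Y, fun hi ↦ hY (((h.isZero_jLeft_obj_iff _).2 hi).of_iso
        (asIso (h.adj_j.counit.app Y)).symm)⟩
    have hnT : Spc.suppOf jIncl.essImage ≠ Set.univ :=
      Spc.suppOf_ne_univ hT ⟨iIncl.obj X, fun hj ↦ hX (((h.isZero_iRight_obj_iff _).2 hj).of_iso
        (asIso (h.adj_i.unit.app X)))⟩
    -- In a preconnected space a clopen set is empty or everything; if empty, its complement is
    -- everything.
    obtain h0 | h1 := isClopen_iff.1 ⟨hcR, hoR⟩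
    · exact hnT (by rw [← hc.compl_eq, h0, Set.compl_empty])
    · exact hnR h1
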